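/- Let $K$ be a field of characteristic $2$, let $A$ be an associative commutative $K$-algebra with unit (of arbitrary dimension), and let $D$ be a nonzero $K$-linear derivation of $A$. Let $S$ be the $3$-dimensional Lie algebra over $K$ with basis $e,h,f$ and $[e,h]=e$, $[f,h]=f$, $[e,f]=h$. Let $L=S\otimes A+KD$ be the semidirect sum of the current Lie algebra $S\otimes A$ (with $[x\otimes a,y\otimes b]=[x,y]\otimes ab$) and $KD$, where $[x\otimes a,D]=x\otimes D(a)$, and grade $L$ by $L_{-1}=e\otimes A$, $L_0=h\otimes A+KD$, $L_1=f\otimes A$, and $L_i=0$ otherwise. A *filtered deformation* of $L$ is a Lie algebra $\mathscr L$ over $K$ having a decreasing filtration by subspaces $(\mathscr L_i)_{i\in\mathbb Z}$ with $[\mathscr L_i,\mathscr L_j]\subseteq\mathscr L_{i+j}$, $\bigcup_i\mathscr L_i=\mathscr L$, $\bigcap_i\mathscr L_i=0$, whose associated graded Lie algebra $\bigoplus_i\mathscr L_i/\mathscr L_{i+1}$ is isomorphic to $L$ as a graded Lie algebra. For a subspace $U\subseteq A$, let $\Xi_{D,U}$ be the set of all linear maps $\xi:A\to K$ that vanish on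 the linear span of all squares of elements of $A$, on $D(A)$ and on $U$, and that satisfy, for all $a,b,c\in A$, $\xi(a)D(b)+\xi(b)D(a)\in U$ and $$\big(\xi(a)b+\xi(b)a+\xi(ab)1\big)D(c)+\big(\xi(c)a+\xi(a)c+\xi(ca)1\big)D(b)+\big(\xi(b)c+\xi(c)b+\xi(bc)1\big)D(a)=0 .$$ Call a triple $(v,w,\xi)$ *admissible* if $v,w\in A$, $D(v)=0$, $\xi\in\Xi_{D,0}$, and $$\big(\xi(ab)c+\xi(ca)b+\xi(bc)a\big)w=0\qquad\text{for all } a,b,c\in A .$$ **Proposition.** (1) For every admissible triple $(v,w,\xi)$ there is exactly one Lie algebra structure $\{\cdot,\cdot\}$ on the vector space $L=S\otimes A+KD$ such that, for all $a,b\in A$, $$\begin{aligned} \{e\otimes a,e\otimes b\}&=\xi(ab)D, & \{e\otimes a,h\otimes b\}&=e\otimes ab+f\otimes\big(abv+\xi(b)D(a)\big),\\ \{e\otimes a,f\otimes b\}&=h\otimes ab, & \{h\otimes a,h\otimes b\}&=0,\\ \{h\otimes a,f\otimes b\}&=f\otimes ab, & \{f\otimes a,f\otimes b\}&=0,\\ \{e\otimes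 a,D\}&=e\otimes D(a)+f\otimes aw, & \{h\otimes a,D\}&=h\otimes D(a),\\ \{f\otimes a,D\}&=f\otimes D(a). && \end{aligned}$$ (2) Every filtered deformation of $L$ is isomorphic, as a Lie algebra, to the Lie algebra with the bracket in (1) for some admissible triple $(v,w,\xi)$. -/

import Mathlib

open scoped TensorProduct

noncomputable section

namespace SmallDeform

/-! ### The three-dimensional simple Lie algebra in characteristic two -/

/-- The underlying space of the three-dimensional Lie algebra `S` with basis `e`, `h`, `f`;
the coordinates are listed in this order. -/
def Ess (K : Type*) : Type _ := Fin 3 → K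

namespace Ess

variable (K : Type*) [Field K]

instance : AddCommGroup (Ess K) := inferInstanceAs (AddCommGroup (Fin 3 → K))

instance : Module K (Ess K) := inferInstanceAs (Module K (Fin 3 → K))

/-- The basis element `e`. -/
def e : Ess K := (![1, 0, 0] : Fin 3 → K)

/-- The basis element `h`. -/
def h : Ess K := (![0, 1, 0] : Fin 3 → K)

/-- The basis element `f`. -/
def f : Ess K := (![0, 0, 1] : Fin 3 → K)

/-- The bilinear alternating bracket with `[e,h] = e`, `[f,h] = f`, `[e,f] = h`. -/
instance : Bracket (Ess K) (Ess K) where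
  bracket x y :=
    (![x 0 * y 1 - x 1 * y 0, x 0 * y 2 - x 2 * y 0, x 2 * y 1 - x 1 * y 2] : Fin 3 → K)

theorem ext_coord {K : Type*} {x y : Ess K} (h0 : x 0 = y 0) (h1 : x 1 = y 1) (h2 : x 2 = y 2) : x = y := by
  funext i
  fin_cases i
  · exact h0
  · exact h1
  · exact h2

variable {K}

theorem add_coord (x y : Ess K) (i : Fin 3) : (x + y) i = x i + y i := rfl

theorem smul_coord (t : K) (x : Ess K) (i : Fin 3) : (t • x) i = t * x i := rfl

theorem zero_coord (i : Fin 3) : (0 : Ess K) i = 0 := rfl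

theorem lie_coord_e (x y : Ess K) : (⁅x, y⁆ : Ess K) 0 = x 0 * y 1 - x 1 * y 0 := rfl

theorem lie_coord_h (x y : Ess K) : (⁅x, y⁆ : Ess K) 1 = x 0 * y 2 - x 2 * y 0 := rfl

theorem lie_coord_f (x y : Ess K) : (⁅x, y⁆ : Ess K) 2 = x 2 * y 1 - x 1 * y 2 := rfl

instance [CharP K 2] : LieRing (Ess K) where
  add_lie x y z := by
    apply ext_coord <;> simp only [add_coord, lie_coord_e, lie_coord_h, lie_coord_f] <;> ring
  lie_add x y z := by
    apply ext_coord <;> simp only [add_coord, lie_coord_e, lie_coord_h, lie_coord_f] <;> ring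
  lie_self x := by
    apply ext_coord <;> simp only [zero_coord, lie_coord_e, lie_coord_h, lie_coord_f] <;> ring
  leibniz_lie x y z := by
    have h2 : (2 : K) = 0 := CharTwo.two_eq_zero
    apply ext_coord <;> simp only [add_coord, lie_coord_e, lie_coord_h, lie_coord_f]
    · ring
    · linear_combination (x 0 * y 2 * z 1 - x 0 * y 1 * z 2 - x 2 * y 0 * z 1
        + x 2 * y 1 * z 0 + x 1 * y 0 * z 2 - x 1 * y 2 * z 0) * h2
    · ring

instance [CharP K 2] : LieAlgebra K (Ess K) where
  lie_smul t x y := by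
    apply ext_coord <;> simp only [smul_coord, lie_coord_e, lie_coord_h, lie_coord_f] <;> ring

theorem lie_e_h : ⁅e K, h K⁆ = e K := by
  apply ext_coord
  · rw [lie_coord_e]; simp [e, h]
  · rw [lie_coord_h]; simp [e, h]
  · rw [lie_coord_f]; simp [e, h]

theorem lie_f_h : ⁅f K, h K⁆ = f K := by
  apply ext_coord
  · rw [lie_coord_e]; simp [f, h]
  · rw [lie_coord_h]; simp [f, h]
  · rw [lie_coord_f]; simp [f, h]

theorem lie_e_f : ⁅e K, f K⁆ = h K := by
  apply ext_coord
  · rw [lie_coord_e]; simp [e, f, h]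
  · rw [lie_coord_h]; simp [e, f, h]
  · rw [lie_coord_f]; simp [e, f, h]

end Ess

/-! ### The semidirect sum `S ⊗ A + KD` -/

section Semidirect

variable {K : Type*} [Field K] [CharP K 2] {A : Type*} [CommRing A] [Algebra K A]

/-- The action of a derivation `E` of `A` on the current Lie algebra, through the factor `A`.
The current Lie algebra `S ⊗ A`, with `[x ⊗ a, y ⊗ b] = [x,y] ⊗ ab`, is Mathlib's extension of
scalars, where the factors are written in the order `A ⊗ S`. -/
def currentDerivation (E : Derivation K A A) :
    LieDerivation K (A ⊗[K] Ess K) (A ⊗[K] Ess K) where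
  toLinearMap := LinearMap.rTensor (Ess K) (E : A →ₗ[K] A)
  leibniz' := by
    intro x y
    induction x using TensorProduct.induction_on with
    | zero => simp
    | add x₁ x₂ h₁ h₂ =>
      simp only [add_lie, lie_add, map_add, h₁, h₂]
      abel
    | tmul a s =>
      induction y using TensorProduct.induction_on with
      | zero => simp
      | add y₁ y₂ h₁ h₂ =>
        simp only [add_lie, lie_add, map_add, h₁, h₂]
        abel
      | tmul b t =>
        simp only [LieAlgebra.ExtendScalars.bracket_tmul, LinearMap.rTensor_tmul,
          Derivation.coeFn_coe, Derivation.leibniz, smul_eq_mul, TensorProduct.add_tmul]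
        rw [← lie_skew s t]
        simp only [TensorProduct.tmul_neg]
        abel

theorem currentDerivation_tmul (E : Derivation K A A) (a : A) (s : Ess K) :
    currentDerivation E (a ⊗ₜ[K] s) = E a ⊗ₜ[K] s := rfl

/-- The homomorphism from `Der(A)` to the derivations of the current Lie algebra. -/
def currentAction : Derivation K A A →ₗ⁅K⁆ LieDerivation K (A ⊗[K] Ess K) (A ⊗[K] Ess K) where
  toFun E := currentDerivation E
  map_add' E F := by
    ext x
    induction x using TensorProduct.induction_on with
    | zero => simp
    | add x₁ x₂ h₁ h₂ => simp only [map_add, h₁, h₂]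
    | tmul a s =>
      simp [currentDerivation_tmul, TensorProduct.add_tmul]
  map_smul' t E := by
    ext x
    induction x using TensorProduct.induction_on with
    | zero => simp
    | add x₁ x₂ h₁ h₂ => simp only [map_add, h₁, h₂]
    | tmul a s =>
      simp [currentDerivation_tmul, TensorProduct.smul_tmul']
  map_lie' := by
    intro E F
    ext x
    induction x using TensorProduct.induction_on with
    | zero => simp
    | add x₁ x₂ h₁ h₂ => simp only [map_add, h₁, h₂]
    | tmul a s =>
      simp [currentDerivation_tmul, Derivation.commutator_apply, TensorProduct.sub_tmul]

/-- The one-generated Lie algebra of derivations `KD`. -/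
def derLine (D : Derivation K A A) : LieSubalgebra K (Derivation K A A) :=
  { Submodule.span K {D} with
    lie_mem' := by
      intro x y hx hy
      obtain ⟨s, rfl⟩ := Submodule.mem_span_singleton.1 hx
      obtain ⟨t, rfl⟩ := Submodule.mem_span_singleton.1 hy
      simp }

/-- The semidirect sum `S ⊗ A + KD`. -/
abbrev CurrentExt (D : Derivation K A A) : Type _ :=
  LieAlgebra.SemiDirectSum (A ⊗[K] Ess K) (derLine D)
    ((currentAction (K := K) (A := A)).comp (derLine D).incl)

/-- The element `s ⊗ a` of `S ⊗ A + KD`, linear in `a`. -/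
def tens (D : Derivation K A A) (s : Ess K) : A →ₗ[K] CurrentExt D :=
  (LieAlgebra.SemiDirectSum.inl
      ((currentAction (K := K) (A := A)).comp (derLine D).incl) :
        (A ⊗[K] Ess K) →ₗ[K] CurrentExt D) ∘ₗ
    (TensorProduct.mk K A (Ess K)).flip s

/-- The element `D` of `S ⊗ A + KD`. -/
def derElt (D : Derivation K A A) : CurrentExt D :=
  ⟨0, ⟨D, Submodule.mem_span_singleton_self D⟩⟩

/-- The standard grading of `S ⊗ A + KD`: the elements `e ⊗ a` have degree `-1`, the elements
`h ⊗ a` and `D` degree `0`, and the elements `f ⊗ a` degree `1`. -/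
def stdGrading (D : Derivation K A A) (i : ℤ) : Submodule K (CurrentExt D) :=
  if i = -1 then LinearMap.range (tens D (Ess.e K))
  else if i = 0 then LinearMap.range (tens D (Ess.h K)) ⊔ Submodule.span K {derElt D}
  else if i = 1 then LinearMap.range (tens D (Ess.f K))
  else ⊥

end Semidirect

/-! ### Filtered Lie algebras and filtered deformations -/

/-- A decreasing, exhaustive and separated filtration of a Lie algebra, indexed by `ℤ`. -/
structure LieFiltration (K : Type*) [Field K] (M : Type*) [LieRing M] [LieAlgebra K M] where
  /-- The terms of the filtration. -/
  F : ℤ → Submodule K M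
  antitone : Antitone F
  lie_mem : ∀ {i j : ℤ} {x y : M}, x ∈ F i → y ∈ F j → ⁅x, y⁆ ∈ F (i + j)
  exhaustive : ⨆ i, F i = ⊤
  separated : ⨅ i, F i = ⊥

namespace LieFiltration

variable {K : Type*} [Field K] {M : Type*} [LieRing M] [LieAlgebra K M]

/-- The component `F i / F (i + 1)` of the associated graded algebra. -/
abbrev Gr (Φ : LieFiltration K M) (i : ℤ) : Type _ :=
  Φ.F i ⧸ (Φ.F (i + 1)).submoduleOf (Φ.F i)

/-- The class in `F i / F (i + 1)` of an element of `F i`. -/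
def symb (Φ : LieFiltration K M) (i : ℤ) : Φ.F i →ₗ[K] Φ.Gr i :=
  ((Φ.F (i + 1)).submoduleOf (Φ.F i)).mkQ

/-- An isomorphism of graded Lie algebras between the associated graded algebra of a filtered Lie
algebra, whose bracket is given on classes by `[x̄, ȳ] = class of ⁅x, y⁆`, and a Lie algebra `L`
with homogeneous components `G i`. -/
structure GradedIso (Φ : LieFiltration K M) {L : Type*} [LieRing L] [LieAlgebra K L]
    (G : ℤ → Submodule K L) where
  /-- The isomorphism in each degree. -/
  toEquiv : ∀ i : ℤ, Φ.Gr i ≃ₗ[K] G i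
  map_lie : ∀ (i j : ℤ) (x : Φ.F i) (y : Φ.F j),
    (toEquiv (i + j) (Φ.symb (i + j) ⟨⁅(x : M), (y : M)⁆, Φ.lie_mem x.2 y.2⟩) : L) =
      ⁅(toEquiv i (Φ.symb i x) : L), (toEquiv j (Φ.symb j y) : L)⁆

end LieFiltration

/-- `M` is a filtered deformation of the Lie algebra `L` graded by the components `G i`: it carries
a filtration whose associated graded algebra is isomorphic to `L` as a graded Lie algebra. -/
def IsFilteredDeformation (K : Type*) [Field K] {L : Type*} [LieRing L] [LieAlgebra K L]
    (G : ℤ → Submodule K L) (M : Type*) [LieRing M] [LieAlgebra K M] : Prop :=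
  ∃ Φ : LieFiltration K M, Nonempty (Φ.GradedIso G)

/-! ### The deformed brackets -/

section Deformed

variable {K : Type*} [Field K] {A : Type*} [CommRing A] [Algebra K A]

/-- The linear maps `ξ : A → K` that form `Ξ_{D,U}`. -/
structure IsXi (D : Derivation K A A) (U : Submodule K A) (ξ : A →ₗ[K] K) : Prop where
  vanish_sq : ∀ a ∈ Submodule.span K (Set.range fun b : A => b ^ 2), ξ a = 0
  vanish_der : ∀ a, ξ (D a) = 0
  vanish_sub : ∀ u ∈ U, ξ u = 0
  mem_sub : ∀ a b, ξ a • D b + ξ b • D a ∈ U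
  long : ∀ a b c,
    (ξ a • b + ξ b • a + ξ (a * b) • (1 : A)) * D c +
      (ξ c • a + ξ a • c + ξ (c * a) • (1 : A)) * D b +
      (ξ b • c + ξ c • b + ξ (b * c) • (1 : A)) * D a = 0

/-- The admissible parameters `v`, `w`, `ξ` of the deformed brackets on `S ⊗ A + KD`. -/
structure IsAdmissible (D : Derivation K A A) (v w : A) (ξ : A →ₗ[K] K) : Prop where
  der_v : D v = 0
  xi : IsXi D ⊥ ξ
  cyclic : ∀ a b c, (ξ (a * b) • c + ξ (c * a) • b + ξ (b * c) • a) * w = 0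

/-- `B` is the alternating bilinear bracket on the space `S ⊗ A + KD` with the displayed values
(they determine `B`). -/
structure IsDeformedBracket [CharP K 2] (D : Derivation K A A) (v w : A) (ξ : A →ₗ[K] K)
    (B : CurrentExt D →ₗ[K] CurrentExt D →ₗ[K] CurrentExt D) : Prop where
  alternating : ∀ x, B x x = 0
  e_e : ∀ a b, B (tens D (Ess.e K) a) (tens D (Ess.e K) b) = ξ (a * b) • derElt D
  e_h : ∀ a b, B (tens D (Ess.e K) a) (tens D (Ess.h K) b) =
    tens D (Ess.e K) (a * b) + tens D (Ess.f K) (a * b * v + ξ b • D a)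
  e_f : ∀ a b, B (tens D (Ess.e K) a) (tens D (Ess.f K) b) = tens D (Ess.h K) (a * b)
  h_h : ∀ a b, B (tens D (Ess.h K) a) (tens D (Ess.h K) b) = 0
  h_f : ∀ a b, B (tens D (Ess.h K) a) (tens D (Ess.f K) b) = tens D (Ess.f K) (a * b)
  f_f : ∀ a b, B (tens D (Ess.f K) a) (tens D (Ess.f K) b) = 0
  e_D : ∀ a, B (tens D (Ess.e K) a) (derElt D) =
    tens D (Ess.e K) (D a) + tens D (Ess.f K) (a * w)
  h_D : ∀ a, B (tens D (Ess.h K) a) (derElt D) = tens D (Ess.h K) (D a)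
  f_D : ∀ a, B (tens D (Ess.f K) a) (derElt D) = tens D (Ess.f K) (D a)

/-- The Jacobi identity for a bilinear bracket. -/
def IsJacobi {L : Type*} [AddCommGroup L] [Module K L] (B : L →ₗ[K] L →ₗ[K] L) : Prop :=
  ∀ x y z, B x (B y z) + B y (B z x) + B z (B x y) = 0

end Deformed

end SmallDeform

end

open scoped TensorProduct

noncomputable section

namespace SmallDeform

set_option linter.unusedSectionVars false

/-! ### Frames and signs in characteristic two -/

section Frame

variable {K : Type*} [Field K] {A : Type*} [CommRing A] [Algebra K A]
  {M : Type*} [AddCommGroup M] [Module K M]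

/-! Part (1) is a computation in coordinates. For `U = 0` the conditions on `ξ` amount to `ξ(a)D(b)
= ξ(b)D(a)`, `ξ(a²) = 0` and `ξ ∘ D = 0`; they give the cyclic identity `cyclic_der_of_symm`, and
with `D v = 0` and the condition on `w` they make every component of the Jacobi sum vanish
(`coordBracket_jacobi`). Uniqueness holds because the displayed values fix an alternating bilinear
map on a spanning family.

For part (2), the filtration runs only from `F (-1) = ⊤` to `F 2 = ⊥`. Lift `h ⊗ 1` to an element
`u` and put `T = ad u`. The graded brackets force `T³ = T` in characteristic 2, so the space splits
into `ker T` and the fixed space of `T²`. Since `T²` is again a derivation, this splitting is a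
`ℤ/2`-grading. The lifts of `h ⊗ A` and `D` can be taken in the even part and those of `e ⊗ A` and
`f ⊗ A` in the odd part, so the bracket differs from that of `L` only by terms raising the degree by
two (`exists_isLieFrame`).

The remaining unknowns are the `f`-parts of `[e,h]` and `[e,D]` and the whole of `[e,e]`. Changing
the lift of `e ⊗ A` by elements lifting `f ⊗ A` normalizes the bracket of `e ⊗ 1` with `h ⊗ A`
(`IsLieFrame.exists_normalized`). The Jacobi identity then expresses all unknowns through `v`, `w`,
`ξ` and yields admissibility (`IsLieFrame.exists_admissible`). -/

/-- The linear map `(a, b, c, t) ↦ E a + H b + F c + t d`. -/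
def frameMap (E H F : A →ₗ[K] M) (d : M) : (A × A × A × K) →ₗ[K] M :=
  E.coprod (H.coprod (F.coprod (LinearMap.toSpanSingleton K M d)))

theorem frameMap_apply (E H F : A →ₗ[K] M) (d : M) (a b c : A) (t : K) :
    frameMap E H F d (a, b, c, t) = E a + (H b + (F c + t • d)) := rfl

theorem add_self_eq_zero_of_charTwo [CharP K 2] (x : M) : x + x = 0 := by
  have h2 : (2 : K) = 0 := CharTwo.two_eq_zero
  rw [← two_smul K x, h2, zero_smul]

theorem neg_eq_of_charTwo (K : Type*) [Field K] [CharP K 2] {M : Type*} [AddCommGroup M]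
    [Module K M] (x : M) : -x = x :=
  neg_eq_of_add_eq_zero_left (add_self_eq_zero_of_charTwo (K := K) x)

end Frame

/-! ### Coordinates on `S ⊗ A + KD` -/

section Coordinates

variable {K : Type*} [Field K] [CharP K 2] {A : Type*} [CommRing A] [Algebra K A]

/-- The `i`-th coordinate of an element of `A ⊗ S`. -/
def coordTensor (i : Fin 3) : A ⊗[K] Ess K →ₗ[K] A :=
  TensorProduct.lift
    (LinearMap.mk₂ K (fun (a : A) (s : Ess K) => s i • a)
      (fun a b s => smul_add _ _ _) (fun t a s => smul_comm _ _ _)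
      (fun a s t => by rw [Ess.add_coord, add_smul])
      (fun t a s => by rw [Ess.smul_coord, mul_smul]))

theorem coordTensor_tmul (i : Fin 3) (a : A) (s : Ess K) :
    coordTensor i (a ⊗ₜ[K] s) = s i • a := rfl

theorem Ess.eq_sum (s : Ess K) : s = s 0 • Ess.e K + s 1 • Ess.h K + s 2 • Ess.f K := by
  apply Ess.ext_coord <;> simp only [Ess.add_coord, Ess.smul_coord] <;> simp [Ess.e, Ess.h, Ess.f]

theorem tensor_eq_sum (x : A ⊗[K] Ess K) :
    x = coordTensor 0 x ⊗ₜ Ess.e K + coordTensor 1 x ⊗ₜ Ess.h K + coordTensor 2 x ⊗ₜ Ess.f K := by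
  induction x using TensorProduct.induction_on with
  | zero => simp
  | add x y hx hy =>
    conv_lhs => rw [hx, hy]
    simp only [map_add, TensorProduct.add_tmul]
    abel
  | tmul a s =>
    conv_lhs => rw [Ess.eq_sum s]
    simp only [coordTensor_tmul, TensorProduct.tmul_add, TensorProduct.tmul_smul,
      TensorProduct.smul_tmul']

variable (D : Derivation K A A)

/-- The condition `D ≠ 0` enters only for the last coordinate: it lets `t` be recovered from `t •
D`. -/
theorem frameMap_std_bijective (hD : D ≠ 0) :
    Function.Bijective
      (frameMap (tens D (Ess.e K)) (tens D (Ess.h K)) (tens D (Ess.f K)) (derElt D)) := by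
  constructor
  · rw [← LinearMap.ker_eq_bot, LinearMap.ker_eq_bot']
    rintro ⟨a, b, c, t⟩ h
    have hl : a ⊗ₜ[K] Ess.e K + (b ⊗ₜ[K] Ess.h K + (c ⊗ₜ[K] Ess.f K + t • (0 : A ⊗[K] Ess K))) = 0 :=
      congrArg (fun x : CurrentExt D => x.left) h
    have hr : (0 : Derivation K A A) + (0 + (0 + t • D)) = 0 :=
      congrArg (fun x : CurrentExt D => ((x.right : derLine D) : Derivation K A A)) h
    have h0 := congrArg (coordTensor (0 : Fin 3)) hl
    have h1 := congrArg (coordTensor (1 : Fin 3)) hl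
    have h2 := congrArg (coordTensor (2 : Fin 3)) hl
    simp only [map_add, coordTensor_tmul, map_zero, smul_zero] at h0 h1 h2
    simp [Ess.e, Ess.h, Ess.f] at h0 h1 h2
    simp_all
  · rintro ⟨x, y, hy⟩
    obtain ⟨t, rfl⟩ := Submodule.mem_span_singleton.1 hy
    refine ⟨(coordTensor 0 x, coordTensor 1 x, coordTensor 2 x, t), ?_⟩
    refine LieAlgebra.SemiDirectSum.ext ?_ ?_
    · change coordTensor 0 x ⊗ₜ[K] Ess.e K + (coordTensor 1 x ⊗ₜ[K] Ess.h K +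
        (coordTensor 2 x ⊗ₜ[K] Ess.f K + t • (0 : A ⊗[K] Ess K))) = x
      conv_rhs => rw [tensor_eq_sum x]
      simp [add_assoc]
    · refine Subtype.ext ?_
      change (0 : Derivation K A A) + (0 + (0 + t • D)) = t • D
      simp

/-- The coordinates `(a, b, c, t)` of an element `e ⊗ a + h ⊗ b + f ⊗ c + t D`. -/
def stdCoord (hD : D ≠ 0) : (A × A × A × K) ≃ₗ[K] CurrentExt D :=
  LinearEquiv.ofBijective _ (frameMap_std_bijective D hD)

theorem stdCoord_apply (hD : D ≠ 0) (a b c : A) (t : K) : stdCoord D hD (a, b, c, t) =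
    tens D (Ess.e K) a + (tens D (Ess.h K) b + (tens D (Ess.f K) c + t • derElt D)) := rfl

end Coordinates

/-! ### The conditions on `ξ` when `U = 0` -/

section Xi

variable {K : Type*} [Field K] [CharP K 2] {A : Type*} [CommRing A] [Algebra K A]
  {D : Derivation K A A}

/-- Symmetry turns `ξ(bc)D(a)` into `ξ(a)D(bc)`. Expanding by the Leibniz rule gives six terms, and
symmetry again matches them in equal pairs, such as `ξ(a) b D(c)` and `ξ(c) b D(a)`, which cancel in
characteristic 2. -/
theorem cyclic_der_of_symm {ξ : A →ₗ[K] K} (hs : ∀ a b, ξ a • D b = ξ b • D a) (a b c : A) :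
    ξ (b * c) • D a + ξ (c * a) • D b + ξ (a * b) • D c = 0 := by
  have h2 := add_self_eq_zero_of_charTwo (K := K) (1 : A)
  have k1 := hs a b
  have k2 := hs b c
  have k3 := hs c a
  rw [hs (b * c), hs (c * a), hs (a * b)]
  simp only [Derivation.leibniz, smul_eq_mul, Algebra.smul_def] at *
  linear_combination a * k2 + b * k3 + c * k1 +
    (algebraMap K A (ξ a) * b * D c + algebraMap K A (ξ b) * c * D a + algebraMap K A (ξ c) * a * D b) * h2

/-- For `U = 0` the long identity is redundant: its terms in `ξ(a)`, `ξ(b)`, `ξ(c)` cancel in pairs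
by symmetry, and the rest is `cyclic_der_of_symm`. -/
theorem isXi_bot_of_symm {ξ : A →ₗ[K] K} (hs : ∀ a b, ξ a • D b = ξ b • D a)
    (hsq : ∀ a, ξ (a * a) = 0) (hder : ∀ a, ξ (D a) = 0) : IsXi D ⊥ ξ where
  vanish_sq a ha := by
    induction ha using Submodule.span_induction with
    | mem x hx => obtain ⟨b, rfl⟩ := hx; simpa [pow_two] using hsq b
    | zero => simp
    | add x y _ _ hx hy => simp [hx, hy]
    | smul t x _ hx => simp [hx]
  vanish_der := hder
  vanish_sub u hu := by simp [(Submodule.mem_bot K).1 hu]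
  mem_sub a b := by
    rw [hs a b, add_self_eq_zero_of_charTwo (K := K)]
    exact Submodule.zero_mem _
  long a b c := by
    have h2 := add_self_eq_zero_of_charTwo (K := K) (1 : A)
    have k1 := hs a b
    have k2 := hs b c
    have k3 := hs c a
    have k4 := cyclic_der_of_symm hs a b c
    simp only [Algebra.smul_def] at *
    linear_combination c * k1 + a * k2 + b * k3 + k4 +
      (algebraMap K A (ξ a) * b * D c + algebraMap K A (ξ b) * c * D a + algebraMap K A (ξ c) * a * D b) * h2

theorem IsXi.symm {ξ : A →ₗ[K] K} (h : IsXi D ⊥ ξ) (a b : A) : ξ a • D b = ξ b • D a := by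
  have := (Submodule.mem_bot K).1 (h.mem_sub a b)
  rwa [add_eq_zero_iff_eq_neg, neg_eq_of_charTwo K] at this

theorem IsXi.apply_mul_self {ξ : A →ₗ[K] K} (h : IsXi D ⊥ ξ) (a : A) : ξ (a * a) = 0 :=
  h.vanish_sq _ (Submodule.subset_span ⟨a, pow_two a⟩)

end Xi

/-! ### The deformed bracket in coordinates and its Jacobi identity -/

section Existence

variable {K : Type*} [Field K] [CharP K 2] {A : Type*} [CommRing A] [Algebra K A]

/-- The deformed bracket in the coordinates `(a, b, c, t)`. -/
def coordBracket (D : Derivation K A A) (v w : A) (ξ : A →ₗ[K] K) :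
    (A × A × A × K) →ₗ[K] (A × A × A × K) →ₗ[K] (A × A × A × K) :=
  LinearMap.mk₂ K
    (fun x y =>
      (x.1 * y.2.1 + y.1 * x.2.1 + y.2.2.2 • D x.1 + x.2.2.2 • D y.1,
        x.1 * y.2.2.1 + y.1 * x.2.2.1 + y.2.2.2 • D x.2.1 + x.2.2.2 • D y.2.1,
        x.1 * y.2.1 * v + ξ y.2.1 • D x.1 + y.1 * x.2.1 * v + ξ x.2.1 • D y.1 +
          y.2.2.2 • (x.1 * w) + x.2.2.2 • (y.1 * w) + x.2.1 * y.2.2.1 + y.2.1 * x.2.2.1 +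
          y.2.2.2 • D x.2.2.1 + x.2.2.2 • D y.2.2.1,
        ξ (x.1 * y.1)))
    (by
      intro x x' y
      simp only [Prod.fst_add, Prod.snd_add, map_add, add_mul, mul_add, smul_add, add_smul,
        Prod.mk_add_mk, Prod.mk.injEq, and_true]
      refine ⟨?_, ?_, ?_⟩ <;> abel)
    (by
      intro s x y
      refine Prod.ext ?_ (Prod.ext ?_ (Prod.ext ?_ ?_)) <;>
        simp only [Prod.smul_fst, Prod.smul_snd, map_smul, Derivation.map_smul, smul_mul_assoc, mul_smul_comm,
          smul_eq_mul] <;> simp only [Algebra.smul_def, map_mul] <;> ring)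
    (by
      intro x y y'
      simp only [Prod.fst_add, Prod.snd_add, map_add, add_mul, mul_add, smul_add, add_smul,
        Prod.mk_add_mk, Prod.mk.injEq, and_true]
      refine ⟨?_, ?_, ?_⟩ <;> abel)
    (by
      intro s x y
      refine Prod.ext ?_ (Prod.ext ?_ (Prod.ext ?_ ?_)) <;>
        simp only [Prod.smul_fst, Prod.smul_snd, map_smul, Derivation.map_smul, smul_mul_assoc, mul_smul_comm,
          smul_eq_mul] <;> simp only [Algebra.smul_def, map_mul] <;> ring)

theorem coordBracket_apply (D : Derivation K A A) (v w : A) (ξ : A →ₗ[K] K) (a b c a' b' c' : A)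
    (t t' : K) : coordBracket D v w ξ (a, b, c, t) (a', b', c', t') =
      (a * b' + a' * b + t' • D a + t • D a',
        a * c' + a' * c + t' • D b + t • D b',
        a * b' * v + ξ b' • D a + a' * b * v + ξ b • D a' +
          t' • (a * w) + t • (a' * w) + b * c' + b' * c + t' • D c + t • D c',
        ξ (a * a')) := rfl

variable {D : Derivation K A A} {v w : A} {ξ : A →ₗ[K] K}

theorem coordBracket_self (h : IsAdmissible D v w ξ) (x : A × A × A × K) :
    coordBracket D v w ξ x x = 0 := by
  have h2 := add_self_eq_zero_of_charTwo (K := K) (1 : A)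
  obtain ⟨a, b, c, t⟩ := x
  rw [coordBracket_apply, h.xi.apply_mul_self]
  simp only [Prod.mk_eq_zero, and_true, Algebra.smul_def]
  refine ⟨?_, ?_, ?_⟩
  · linear_combination (a * b + algebraMap K A t * D a) * h2
  · linear_combination (a * c + algebraMap K A t * D b) * h2
  · linear_combination (a * b * v + algebraMap K A (ξ b) * D a + algebraMap K A t * (a * w) +
      b * c + algebraMap K A t * D c) * h2

-- The `e`-component reduces to the cyclic identity, the `h`-component to the symmetry of `ξ`
-- evaluated at products, and the `D`-component to `ξ ∘ D = 0`. The `f`-component uses all the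
-- admissibility conditions that enter the other components, together with `D v = 0` and the
-- condition on `w`.
set_option maxHeartbeats 2000000 in
theorem coordBracket_jacobi (h : IsAdmissible D v w ξ) : IsJacobi (coordBracket D v w ξ) := by
  have h2 := add_self_eq_zero_of_charTwo (K := K) (1 : A)
  -- Ring normalization does not see the characteristic. The even coefficients it leaves behind, 2
  -- and in one component 4, are removed with these equalities.
  have h2A : (2 : A) = 0 := by linear_combination h2
  have h4A : (4 : A) = 0 := by linear_combination 2 * h2A
  have h2K : (2 : K) = 0 := CharTwo.two_eq_zero
  rintro ⟨a, b, c, t⟩ ⟨a', b', c', t'⟩ ⟨a'', b'', c'', t''⟩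
  simp only [coordBracket_apply, Prod.mk_add_mk, Prod.mk_eq_zero]
  have s1 := h.xi.symm
  have s2 := cyclic_der_of_symm s1
  have s3 := h.cyclic
  have s4 := h.der_v
  have s5 := h.xi.vanish_der
  refine ⟨?_, ?_, ?_, ?_⟩
  · have k := s2 a a' a''
    simp only [map_add, Derivation.leibniz, smul_eq_mul, Algebra.smul_def,
      Derivation.map_algebraMap] at k ⊢
    linear_combination (norm := (ring_nf; simp only [h2A, mul_zero, add_zero])) k
  · have k1 := s1 b (a' * a'')
    have k2 := s1 b' (a'' * a)
    have k3 := s1 b'' (a * a')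
    simp only [map_add, Derivation.leibniz, smul_eq_mul, Algebra.smul_def,
      Derivation.map_algebraMap] at k1 k2 k3 ⊢
    linear_combination (norm := (ring_nf; simp only [h2A, mul_zero, add_zero])) k1 + k2 + k3
  · have k1 := s2 a a' c''
    have k2 := s2 a a'' c'
    have k3 := s2 a' a'' c
    have k4 := s1 b b'
    have k5 := s1 b' b''
    have k6 := s1 b'' b
    have k7 := s3 a a' a''
    simp only [map_add, map_smul, s5, smul_zero]
    simp only [map_add, Derivation.leibniz, smul_eq_mul, Algebra.smul_def,
      Derivation.map_algebraMap, s4, map_zero] at k1 k2 k3 k4 k5 k6 k7 ⊢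
    linear_combination (norm := (ring_nf; simp only [h2A, h4A, mul_zero, add_zero]))
      k1 + k2 + k3 + a'' * k4 + a * k5 + a' * k6 + k7
  · have k1 := s5 (a * a')
    have k2 := s5 (a' * a'')
    have k3 := s5 (a'' * a)
    simp only [map_add, map_smul, Derivation.leibniz, smul_eq_mul, mul_add, mul_smul_comm] at *
    linear_combination (norm := (ring_nf; simp only [h2K, mul_zero, add_zero]))
      t'' * k1 + t * k2 + t' * k3

end Existence

/-! ### Alternating brackets are determined on a frame -/

section BracketExt

variable {K : Type*} [Field K] [CharP K 2] {A : Type*} [CommRing A] [Algebra K A]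
  {M : Type*} [AddCommGroup M] [Module K M] {N : Type*} [AddCommGroup N] [Module K N]

theorem alternating_symm {B : M →ₗ[K] M →ₗ[K] N} (hB : ∀ x, B x x = 0) (x y : M) :
    B x y = B y x := by
  have := hB (x + y)
  simp only [map_add, LinearMap.add_apply, hB, zero_add, add_zero] at this
  rw [add_eq_zero_iff_eq_neg, neg_eq_of_charTwo K] at this
  exact this.symm

theorem alternating_ext_frame {E H F : A →ₗ[K] M} {d : M}
    (hs : Function.Surjective (frameMap E H F d)) {B C : M →ₗ[K] M →ₗ[K] N}
    (hB : ∀ x, B x x = 0) (hC : ∀ x, C x x = 0)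
    (ee : ∀ a b, B (E a) (E b) = C (E a) (E b)) (eh : ∀ a b, B (E a) (H b) = C (E a) (H b))
    (ef : ∀ a b, B (E a) (F b) = C (E a) (F b)) (hh : ∀ a b, B (H a) (H b) = C (H a) (H b))
    (hf : ∀ a b, B (H a) (F b) = C (H a) (F b)) (ff : ∀ a b, B (F a) (F b) = C (F a) (F b))
    (ed : ∀ a, B (E a) d = C (E a) d) (hd : ∀ a, B (H a) d = C (H a) d)
    (fd : ∀ a, B (F a) d = C (F a) d) : B = C := by
  ext x y
  obtain ⟨⟨a, b, c, t⟩, rfl⟩ := hs x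
  obtain ⟨⟨a', b', c', t'⟩, rfl⟩ := hs y
  have sB := alternating_symm hB
  have sC := alternating_symm hC
  simp only [frameMap_apply, map_add, LinearMap.add_apply, map_smul, LinearMap.smul_apply, ee, eh,
    ef, hh, hf, ff, ed, hd, fd, hB, hC, sB (H _) (E _), sB (F _) (E _), sB (F _) (H _), sB d (E _),
    sB d (H _), sB d (F _), sC (H _) (E _), sC (F _) (E _), sC (F _) (H _), sC d (E _), sC d (H _),
    sC d (F _)]

end BracketExt

/-! ### Transport to `S ⊗ A + KD`: existence and uniqueness -/

section PartOne

variable {K : Type*} [Field K] [CharP K 2] {A : Type*} [CommRing A] [Algebra K A]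
  {D : Derivation K A A}

theorem stdCoord_symm_e (hD : D ≠ 0) (a : A) :
    (stdCoord D hD).symm (tens D (Ess.e K) a) = (a, 0, 0, 0) := by
  rw [LinearEquiv.symm_apply_eq, stdCoord_apply]
  simp only [map_zero, zero_smul, add_zero]

theorem stdCoord_symm_h (hD : D ≠ 0) (a : A) :
    (stdCoord D hD).symm (tens D (Ess.h K) a) = (0, a, 0, 0) := by
  rw [LinearEquiv.symm_apply_eq, stdCoord_apply]
  simp only [map_zero, zero_smul, add_zero, zero_add]

theorem stdCoord_symm_f (hD : D ≠ 0) (a : A) :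
    (stdCoord D hD).symm (tens D (Ess.f K) a) = (0, 0, a, 0) := by
  rw [LinearEquiv.symm_apply_eq, stdCoord_apply]
  simp only [map_zero, zero_smul, add_zero, zero_add]

theorem stdCoord_symm_d (hD : D ≠ 0) : (stdCoord D hD).symm (derElt D) = (0, 0, 0, 1) := by
  rw [LinearEquiv.symm_apply_eq, stdCoord_apply]
  simp only [map_zero, one_smul, zero_add]

/-- The deformed bracket on `S ⊗ A + KD`. -/
def deformedBracket (hD : D ≠ 0) (v w : A) (ξ : A →ₗ[K] K) :
    CurrentExt D →ₗ[K] CurrentExt D →ₗ[K] CurrentExt D :=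
  ((coordBracket D v w ξ).compl₁₂ (stdCoord D hD).symm.toLinearMap
    (stdCoord D hD).symm.toLinearMap).compr₂ (stdCoord D hD).toLinearMap

theorem deformedBracket_apply (hD : D ≠ 0) (v w : A) (ξ : A →ₗ[K] K) (x y : CurrentExt D) :
    deformedBracket hD v w ξ x y =
      stdCoord D hD (coordBracket D v w ξ ((stdCoord D hD).symm x) ((stdCoord D hD).symm y)) :=
  rfl

variable {v w : A} {ξ : A →ₗ[K] K}

theorem isDeformedBracket_deformedBracket (hD : D ≠ 0) (h : IsAdmissible D v w ξ) :
    IsDeformedBracket D v w ξ (deformedBracket hD v w ξ) := by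
  constructor <;> intros <;>
  simp only [deformedBracket_apply, coordBracket_self h, stdCoord_symm_e, stdCoord_symm_h,
    stdCoord_symm_f, stdCoord_symm_d, coordBracket_apply, mul_zero, zero_mul, map_zero, zero_smul,
    smul_zero, add_zero, zero_add, one_smul, stdCoord_apply]

theorem isJacobi_deformedBracket (hD : D ≠ 0) (h : IsAdmissible D v w ξ) :
    IsJacobi (deformedBracket hD v w ξ) := by
  intro x y z
  simp only [deformedBracket_apply, LinearEquiv.symm_apply_apply, ← map_add]
  rw [coordBracket_jacobi h, map_zero]

theorem IsDeformedBracket.unique (hD : D ≠ 0)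
    {B C : CurrentExt D →ₗ[K] CurrentExt D →ₗ[K] CurrentExt D}
    (hB : IsDeformedBracket D v w ξ B) (hC : IsDeformedBracket D v w ξ C) : B = C := by
  apply alternating_ext_frame (frameMap_std_bijective D hD).2 hB.alternating hC.alternating
  · intro a b; rw [hB.e_e, hC.e_e]
  · intro a b; rw [hB.e_h, hC.e_h]
  · intro a b; rw [hB.e_f, hC.e_f]
  · intro a b; rw [hB.h_h, hC.h_h]
  · intro a b; rw [hB.h_f, hC.h_f]
  · intro a b; rw [hB.f_f, hC.f_f]
  · intro a; rw [hB.e_D, hC.e_D]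
  · intro a; rw [hB.h_D, hC.h_D]
  · intro a; rw [hB.f_D, hC.f_D]

theorem existsUnique_deformedBracket (hD : D ≠ 0) (h : IsAdmissible D v w ξ) :
    ∃! B : CurrentExt D →ₗ[K] CurrentExt D →ₗ[K] CurrentExt D,
      IsDeformedBracket D v w ξ B ∧ IsJacobi B :=
  ⟨_, ⟨isDeformedBracket_deformedBracket hD h, isJacobi_deformedBracket hD h⟩,
    fun _ hB => hB.1.unique hD (isDeformedBracket_deformedBracket hD h)⟩

end PartOne

/-! ### From a Lie frame to admissible parameters -/

section LieFrame

variable {K : Type*} [Field K] [CharP K 2] {A : Type*} [CommRing A] [Algebra K A]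
  {M : Type*} [LieRing M] [LieAlgebra K M]

/-- The bracket of `M` agrees, in terms of the frame `E`, `H`, `F`, `d`, with that of
`S ⊗ A + KD` up to terms that raise the degree by two. -/
structure IsLieFrame (D : Derivation K A A) (E H F : A →ₗ[K] M) (d : M) : Prop where
  bijective : Function.Bijective (frameMap E H F d)
  e_e : ∀ a b, ∃ (c : A) (t : K), ⁅E a, E b⁆ = H c + t • d
  e_h : ∀ a b, ∃ c, ⁅E a, H b⁆ = E (a * b) + F c
  e_f : ∀ a b, ⁅E a, F b⁆ = H (a * b)
  e_d : ∀ a, ∃ c, ⁅E a, d⁆ = E (D a) + F c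
  h_h : ∀ a b, ⁅H a, H b⁆ = 0
  h_f : ∀ a b, ⁅H a, F b⁆ = F (a * b)
  h_d : ∀ a, ⁅H a, d⁆ = H (D a)
  f_f : ∀ a b, ⁅F a, F b⁆ = 0
  f_d : ∀ a, ⁅F a, d⁆ = F (D a)

theorem lie_comm_of_charTwo (K : Type*) [Field K] [CharP K 2] {M : Type*} [LieRing M]
    [LieAlgebra K M] (x y : M) : ⁅x, y⁆ = ⁅y, x⁆ := by
  rw [← lie_skew, neg_eq_of_charTwo K]

variable {D : Derivation K A A} {E H F : A →ₗ[K] M} {d : M}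

/-- These projections allow Jacobi identities to be compared component by component. -/
theorem IsLieFrame.exists_coord (h : IsLieFrame D E H F d) :
    ∃ (pE pH pF : M →ₗ[K] A) (pd : M →ₗ[K] K),
      ((∀ a, pE (E a) = a) ∧ (∀ a, pE (H a) = 0) ∧ (∀ a, pE (F a) = 0) ∧ pE d = 0) ∧
      ((∀ a, pH (E a) = 0) ∧ (∀ a, pH (H a) = a) ∧ (∀ a, pH (F a) = 0) ∧ pH d = 0) ∧
      ((∀ a, pF (E a) = 0) ∧ (∀ a, pF (H a) = 0) ∧ (∀ a, pF (F a) = a) ∧ pF d = 0) ∧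
      ((∀ a, pd (E a) = 0) ∧ (∀ a, pd (H a) = 0) ∧ (∀ a, pd (F a) = 0) ∧ pd d = 1) := by
  set Φ := LinearEquiv.ofBijective _ h.bijective
  have hΦ (a b c t) : Φ (a, b, c, t) = E a + (H b + (F c + t • d)) := rfl
  have kE (a) : Φ.symm (E a) = (a, 0, 0, 0) := by
    rw [LinearEquiv.symm_apply_eq, hΦ]; simp
  have kH (a) : Φ.symm (H a) = (0, a, 0, 0) := by
    rw [LinearEquiv.symm_apply_eq, hΦ]; simp
  have kF (a) : Φ.symm (F a) = (0, 0, a, 0) := by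
    rw [LinearEquiv.symm_apply_eq, hΦ]; simp
  have kd : Φ.symm d = (0, 0, 0, 1) := by
    rw [LinearEquiv.symm_apply_eq, hΦ]; simp
  refine ⟨LinearMap.fst K _ _ ∘ₗ Φ.symm.toLinearMap,
    LinearMap.fst K _ _ ∘ₗ LinearMap.snd K _ _ ∘ₗ Φ.symm.toLinearMap,
    LinearMap.fst K _ _ ∘ₗ LinearMap.snd K _ _ ∘ₗ LinearMap.snd K _ _ ∘ₗ Φ.symm.toLinearMap,
    LinearMap.snd K _ _ ∘ₗ LinearMap.snd K _ _ ∘ₗ LinearMap.snd K _ _ ∘ₗ Φ.symm.toLinearMap, ?_⟩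
  simp [kE, kH, kF, kd]

/-- This is the freedom in choosing the lift of `e ⊗ A`. As `[F,F] = 0`, the bracket of `E` with `F`
is unaffected, and the other changes are absorbed by the free terms of the frame relations. -/
theorem IsLieFrame.add_comp (h : IsLieFrame D E H F d) (g : A →ₗ[K] A) :
    IsLieFrame D (E + F ∘ₗ g) H F d where
  bijective := by
    constructor
    · rw [← LinearMap.ker_eq_bot, LinearMap.ker_eq_bot']
      rintro ⟨a, b, c, t⟩ h0
      have h1 : frameMap E H F d (a, b, c + g a, t) = 0 := by
        rw [← h0, frameMap_apply, frameMap_apply, LinearMap.add_apply, LinearMap.comp_apply, map_add]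
        abel
      have h2 := h.bijective.1 (h1.trans (map_zero _).symm)
      simp only [Prod.mk_eq_zero] at h2 ⊢
      obtain ⟨rfl, rfl, h3, rfl⟩ := h2
      simpa using h3
    · intro x
      obtain ⟨⟨a, b, c, t⟩, rfl⟩ := h.bijective.2 x
      refine ⟨(a, b, c - g a, t), ?_⟩
      rw [frameMap_apply, frameMap_apply, LinearMap.add_apply, LinearMap.comp_apply, map_sub]
      abel
  e_e a b := by
    obtain ⟨c, t, hc⟩ := h.e_e a b
    refine ⟨c + a * g b + b * g a, t, ?_⟩
    simp only [LinearMap.add_apply, LinearMap.comp_apply, add_lie, lie_add, hc, h.e_f, h.f_f,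
      lie_comm_of_charTwo K (F _) (E _), map_add]
    abel
  e_h a b := by
    obtain ⟨c, hc⟩ := h.e_h a b
    refine ⟨c + b * g a - g (a * b), ?_⟩
    simp only [LinearMap.add_apply, LinearMap.comp_apply, add_lie, hc, h.h_f,
      lie_comm_of_charTwo K (F _) (H _), map_add, map_sub]
    abel
  e_f a b := by
    simp only [LinearMap.add_apply, LinearMap.comp_apply, add_lie, h.e_f, h.f_f, add_zero]
  e_d a := by
    obtain ⟨c, hc⟩ := h.e_d a
    refine ⟨c + D (g a) - g (D a), ?_⟩
    simp only [LinearMap.add_apply, LinearMap.comp_apply, add_lie, hc, h.f_d,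
      map_add, map_sub]
    abel
  h_h := h.h_h
  h_f := h.h_f
  h_d := h.h_d
  f_f := h.f_f
  f_d := h.f_d

/-- Take `g b` to be the `F`-component of `⁅E 1, H b⁆` and replace `E` by `E + F ∘ g`. The term `F
(g b)` becomes part of the new `E' b`, and only `⁅F (g 1), H b⁆ = F (b * g 1)` is left over, whence
`v = g 1`. -/
theorem IsLieFrame.exists_normalized (h : IsLieFrame D E H F d) :
    ∃ (E' : A →ₗ[K] M) (v : A), IsLieFrame D E' H F d ∧
      ∀ b, ⁅E' 1, H b⁆ = E' b + F (b * v) := by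
  obtain ⟨-, -, pF, -, -, -, ⟨p1, p2, p3, p4⟩, -⟩ := h.exists_coord
  set g : A →ₗ[K] A := pF ∘ₗ (LieModule.toEnd K M M (E 1)) ∘ₗ H with hg
  refine ⟨E + F ∘ₗ g, g 1, h.add_comp g, fun b => ?_⟩
  obtain ⟨c, hc⟩ := h.e_h 1 b
  have hgb : g b = c := by
    simp [hg, hc, p1, p3]
  simp only [LinearMap.add_apply, LinearMap.comp_apply, add_lie, hc, ← hgb, one_mul,
    lie_comm_of_charTwo K (F _) (H _), h.h_f]

/-- Each relation comes from one Jacobi identity. The triples `(E,E,F)` and `(E,H,H)` determine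
`[E,H]` and `[E,E]`; `(E,E,d)` gives `ξ ∘ D = 0` and the form of `[E,d]`; `(E 1, H 1, d)` gives `D v
= 0`; and `(E,E,E)` gives the condition on `w`. -/
theorem IsLieFrame.exists_admissible (h : IsLieFrame D E H F d) (hD : D ≠ 0) {v : A}
    (hv : ∀ b, ⁅E 1, H b⁆ = E b + F (b * v)) :
    ∃ (w : A) (ξ : A →ₗ[K] K), IsAdmissible D v w ξ ∧ (∀ a b, ⁅E a, E b⁆ = ξ (a * b) • d) ∧
      (∀ a b, ⁅E a, H b⁆ = E (a * b) + F (a * b * v + ξ b • D a)) ∧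
      ∀ a, ⁅E a, d⁆ = E (D a) + F (a * w) := by
  have h2A : (2 : A) = 0 := by
    have := add_self_eq_zero_of_charTwo (K := K) (1 : A)
    linear_combination this
  obtain ⟨pE, pH, pF, pd, ⟨pE1, pE2, pE3, pE4⟩, ⟨pH1, pH2, pH3, pH4⟩, ⟨pF1, pF2, pF3, pF4⟩,
    ⟨pd1, pd2, pd3, pd4⟩⟩ := h.exists_coord
  choose β γ hee using h.e_e
  choose l heh using h.e_h
  choose m hed using h.e_d
  have hef := h.e_f
  have hhe (a b) : ⁅H b, E a⁆ = E (a * b) + F (l a b) := by rw [lie_comm_of_charTwo K, heh]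
  have hde (a) : ⁅d, E a⁆ = E (D a) + F (m a) := by rw [lie_comm_of_charTwo K, hed]
  have hfe (a b) : ⁅F b, E a⁆ = H (a * b) := by rw [lie_comm_of_charTwo K, hef]
  have hfh (a b) : ⁅F b, H a⁆ = F (a * b) := by rw [lie_comm_of_charTwo K, h.h_f]
  have hdf (a) : ⁅d, F a⁆ = F (D a) := by rw [lie_comm_of_charTwo K, h.f_d]
  have hl1 (b) : l 1 b = b * v := by
    have := congrArg pF (hv b)
    rwa [heh, map_add, map_add, pF1, pF1, pF3, pF3, zero_add, zero_add] at this
  have J1 (a b c : A) : l a (b * c) + l b (a * c) + (β a b * c + γ a b • D c) = 0 := by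
    have := congrArg pF (lie_jacobi (E a) (E b) (F c))
    simpa [hef, hfe, heh, hee, hfh, h.f_d, pF1, pF2, pF3, pF4] using this
  have J2 (a b c : A) : l (a * c) b + b * l a c + (l (a * b) c + c * l a b) = 0 := by
    have := congrArg pF (lie_jacobi (E a) (H b) (H c))
    simpa [h.h_h, heh, hhe, h.h_f, pF1, pF2, pF3, pF4] using this
  -- With the first argument equal to 1, the normalization makes the two terms `abv` cancel.
  have hsymm (a b : A) : l a b = l b a := by
    have := J2 1 b a
    rw [hl1, hl1, one_mul, one_mul] at this
    linear_combination this - (a * b * v + l b a) * h2A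
  have hβ (a b : A) : β a b = 0 := by
    have := J1 a b 1
    rw [mul_one, mul_one, mul_one, hsymm a b, Derivation.map_one_eq_zero, smul_zero] at this
    linear_combination this - l b a * h2A
  -- The functional is the `d`-coefficient of `⁅E 1, E a⁆`; defining it through the bracket makes it
  -- visibly linear, which the chosen function `γ` is not.
  set ξ : A →ₗ[K] K := pd ∘ₗ (LieModule.toEnd K M M (E 1)) ∘ₗ E with hξ
  have hγ1 (a) : γ 1 a = ξ a := by
    simp [hξ, hee, pd2, pd4]
  have hl' (a b : A) : l a b = a * b * v + ξ a • D b := by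
    have := J1 1 a b
    rw [hl1, one_mul, hβ, zero_mul, hγ1] at this
    linear_combination this - (a * b * v + ξ a • D b) * h2A
  have hs (a b : A) : ξ a • D b = ξ b • D a := by
    have h1 := hl' a b
    rw [hsymm, hl' b a] at h1
    linear_combination -h1
  have hl (a b : A) : l a b = a * b * v + ξ b • D a := by rw [hl', hs]
  -- Both sides are scalars, so it suffices to compare them after multiplying by one nonzero value
  -- `D c`; there `J1` and the cyclic identity agree.
  have hγ (a b : A) : γ a b = ξ (a * b) := by
    obtain ⟨c, hc⟩ : ∃ c, D c ≠ 0 := by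
      by_contra! hcon
      exact hD (Derivation.ext hcon)
    have h1 := J1 a b c
    rw [hβ, hl, hl] at h1
    have h3 := cyclic_der_of_symm hs a b c
    rw [mul_comm c a] at h3
    have h4 : (γ a b - ξ (a * b)) • D c = 0 := by
      rw [sub_smul]
      linear_combination h1 - h3 - a * b * c * v * h2A
    exact sub_eq_zero.1 ((smul_eq_zero.1 h4).resolve_right hc)
  have hsq (a : A) : ξ (a * a) = 0 := by
    have := congrArg pd (lie_self (E a))
    rw [hee, hβ, hγ] at this
    simpa [pd4] using this
  have J3 (a b : A) : ξ (a * D b) + ξ (b * D a) = 0 ∧ a * m b + b * m a = 0 := by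
    -- The `d`-component gives the relation for `ξ`, the `H`-component the one for `m`; setting one
    -- argument to 1 later yields `ξ ∘ D = 0` and `m a = a * m 1`.
    have h1 := lie_jacobi (E a) (E b) d
    have h2 := congrArg pd h1
    have h3 := congrArg pH h1
    simp [hed, hde, hee, hef, hγ, hβ, pd2, pd4] at h2
    simp [hed, hde, hee, hef, hγ, hβ, pH2, pH4] at h3
    exact ⟨h2, h3⟩
  have hm (a : A) : m a = a * m 1 := by
    have := (J3 a 1).2
    linear_combination this - a * m 1 * h2A
  have hder (a : A) : ξ (D a) = 0 := by
    simpa using (J3 1 a).1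
  have hDv : D v = 0 := by
    have := congrArg pF (lie_jacobi (E 1) (H 1) d)
    simp [hde, heh, h.h_d, hdf, hl, h.h_f, pF3] at this
    linear_combination this - m 1 * h2A
  have J4 (a b c : A) : (ξ (a * b) • c + ξ (c * a) • b + ξ (b * c) • a) * m 1 = 0 := by
    have := congrArg pF (lie_jacobi (E a) (E b) (E c))
    simp [hee, hβ, hγ, hed, pF1, pF3, hm a, hm b, hm c] at this
    simp only [Algebra.smul_def] at this ⊢
    linear_combination this
  refine ⟨m 1, ξ, ⟨hDv, isXi_bot_of_symm hs hsq hder, J4⟩, fun a b => ?_, fun a b => ?_,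
    fun a => ?_⟩
  · rw [hee, hβ, hγ, map_zero, zero_add]
  · rw [heh, hl]
  · rw [hed, hm]

theorem IsLieFrame.exists_deformedBracket (h : IsLieFrame D E H F d) (hD : D ≠ 0) :
    ∃ (v w : A) (ξ : A →ₗ[K] K), IsAdmissible D v w ξ ∧
      ∃ B : CurrentExt D →ₗ[K] CurrentExt D →ₗ[K] CurrentExt D,
        IsDeformedBracket D v w ξ B ∧
          ∃ φ : M ≃ₗ[K] CurrentExt D, ∀ x y : M, φ ⁅x, y⁆ = B (φ x) (φ y) := by
  obtain ⟨E', v, h', hv⟩ := h.exists_normalized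
  obtain ⟨w, ξ, hadm, hee, heh, hed⟩ := h'.exists_admissible hD hv
  set Φ := LinearEquiv.ofBijective _ h'.bijective
  have hΦ (a b c t) : Φ (a, b, c, t) = E' a + (H b + (F c + t • d)) := rfl
  set φ : M ≃ₗ[K] CurrentExt D := Φ.symm.trans (stdCoord D hD)
  have kE (a) : φ.symm (tens D (Ess.e K) a) = E' a := by
    change Φ ((stdCoord D hD).symm _) = _
    rw [stdCoord_symm_e, hΦ]; simp
  have kH (a) : φ.symm (tens D (Ess.h K) a) = H a := by
    change Φ ((stdCoord D hD).symm _) = _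
    rw [stdCoord_symm_h, hΦ]; simp
  have kF (a) : φ.symm (tens D (Ess.f K) a) = F a := by
    change Φ ((stdCoord D hD).symm _) = _
    rw [stdCoord_symm_f, hΦ]; simp
  have kd : φ.symm (derElt D) = d := by
    change Φ ((stdCoord D hD).symm _) = _
    rw [stdCoord_symm_d, hΦ]; simp
  refine ⟨v, w, ξ, hadm, (((LieModule.toEnd K M M : M →ₗ[K] Module.End K M).compl₁₂ φ.symm.toLinearMap
    φ.symm.toLinearMap).compr₂ φ.toLinearMap), ?_, φ, fun x y => ?_⟩
  · have key (x y : CurrentExt D) (z : CurrentExt D) (hz : ⁅φ.symm x, φ.symm y⁆ = φ.symm z) :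
        (((LieModule.toEnd K M M : M →ₗ[K] Module.End K M).compl₁₂ φ.symm.toLinearMap
          φ.symm.toLinearMap).compr₂ φ.toLinearMap) x y = z := by
      change φ ⁅φ.symm x, φ.symm y⁆ = z
      rw [hz, LinearEquiv.apply_symm_apply]
    constructor <;> intros <;> apply key <;>
      simp only [lie_self, kE, kH, kF, kd, map_zero, map_add, map_smul, hee, heh, hed, h'.e_f,
        h'.h_h, h'.h_f, h'.f_f, h'.h_d, h'.f_d]
  · change _ = φ ⁅φ.symm (φ x), φ.symm (φ y)⁆
    rw [LinearEquiv.symm_apply_apply, LinearEquiv.symm_apply_apply]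

end LieFrame

/-! ### Brackets and homogeneous components of the graded algebra -/

section StandardBracket

variable {K : Type*} [Field K] [CharP K 2] {A : Type*} [CommRing A] [Algebra K A]
  (D : Derivation K A A)

theorem lie_tens_tens (s s' : Ess K) (a b : A) :
    ⁅tens D s a, tens D s' b⁆ = tens D ⁅s, s'⁆ (a * b) := by
  change ⁅LieAlgebra.SemiDirectSum.inl _ (a ⊗ₜ[K] s), LieAlgebra.SemiDirectSum.inl _ (b ⊗ₜ[K] s')⁆ =
    LieAlgebra.SemiDirectSum.inl _ ((a * b) ⊗ₜ[K] ⁅s, s'⁆)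
  rw [← LieHom.map_lie, LieAlgebra.ExtendScalars.bracket_tmul]

theorem tens_zero (a : A) : tens D 0 a = 0 := by
  change LieAlgebra.SemiDirectSum.inl _ (a ⊗ₜ[K] (0 : Ess K)) = 0
  rw [TensorProduct.tmul_zero, map_zero]

theorem lie_tens_derElt (s : Ess K) (a : A) : ⁅tens D s a, derElt D⁆ = tens D s (D a) := by
  rw [← neg_eq_of_charTwo K (tens D s (D a))]
  refine LieAlgebra.SemiDirectSum.ext ?_ ?_
  · change ⁅a ⊗ₜ[K] s, (0 : A ⊗[K] Ess K)⁆ + currentAction (0 : Derivation K A A) 0 -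
      currentAction D (a ⊗ₜ[K] s) = -(D a ⊗ₜ[K] s)
    have h0 : ⁅a ⊗ₜ[K] s, (0 : A ⊗[K] Ess K)⁆ = 0 := lie_zero (a ⊗ₜ[K] s)
    rw [h0, map_zero, add_zero, zero_sub]
    rfl
  · change ⁅(0 : derLine D), (⟨D, Submodule.mem_span_singleton_self D⟩ : derLine D)⁆ = -0
    rw [zero_lie, neg_zero]

theorem stdGrading_neg_one : stdGrading D (-1) = LinearMap.range (tens D (Ess.e K)) := by
  simp [stdGrading]

theorem mem_stdGrading_zero {y : CurrentExt D} :
    y ∈ stdGrading D 0 ↔ ∃ (b : A) (t : K), y = tens D (Ess.h K) b + t • derElt D := by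
  have : stdGrading D 0 = LinearMap.range (tens D (Ess.h K)) ⊔ Submodule.span K {derElt D} := by
    simp [stdGrading]
  rw [this, Submodule.mem_sup]
  constructor
  · rintro ⟨_, ⟨b, rfl⟩, z, hz, rfl⟩
    obtain ⟨t, rfl⟩ := Submodule.mem_span_singleton.1 hz
    exact ⟨b, t, rfl⟩
  · rintro ⟨b, t, rfl⟩
    exact ⟨_, ⟨b, rfl⟩, _, Submodule.smul_mem _ t (Submodule.mem_span_singleton_self _), rfl⟩

theorem stdGrading_one : stdGrading D 1 = LinearMap.range (tens D (Ess.f K)) := by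
  simp [stdGrading]

theorem stdGrading_eq_bot {i : ℤ} (h1 : i ≠ -1) (h2 : i ≠ 0) (h3 : i ≠ 1) :
    stdGrading D i = ⊥ := by
  simp [stdGrading, h1, h2, h3]

end StandardBracket

/-! ### Symbol calculus for a filtered deformation -/

section Symbols

variable {K : Type*} [Field K] {M : Type*} [LieRing M] [LieAlgebra K M]
  {L : Type*} [LieRing L] [LieAlgebra K L] {G : ℤ → Submodule K L} {Φ : LieFiltration K M}

/-- The symbol map of degree `i`, with values in the graded algebra. -/
def LieFiltration.GradedIso.symbol (Θ : Φ.GradedIso G) (i : ℤ) : Φ.F i →ₗ[K] L :=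
  (G i).subtype ∘ₗ (Θ.toEquiv i).toLinearMap ∘ₗ Φ.symb i

/-- The element `y` of degree `i` is the symbol of `x`. -/
def LieFiltration.GradedIso.HasSymbol (Θ : Φ.GradedIso G) (i : ℤ) (x : M) (y : L) : Prop :=
  ∃ hx : x ∈ Φ.F i, Θ.symbol i ⟨x, hx⟩ = y

namespace LieFiltration.GradedIso

variable {Θ : Φ.GradedIso G} {i j k : ℤ} {x x' : M} {y y' : L}

theorem symbol_eq_zero_iff (x : Φ.F i) : Θ.symbol i x = 0 ↔ (x : M) ∈ Φ.F (i + 1) := by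
  change ((Θ.toEquiv i (Φ.symb i x) : G i) : L) = 0 ↔ _
  rw [ZeroMemClass.coe_eq_zero, LinearEquiv.map_eq_zero_iff]
  exact Submodule.Quotient.mk_eq_zero _

theorem exists_symbol_eq (hy : y ∈ G i) : ∃ x : Φ.F i, Θ.symbol i x = y := by
  obtain ⟨x, hx⟩ := Submodule.mkQ_surjective _ ((Θ.toEquiv i).symm ⟨y, hy⟩)
  refine ⟨x, ?_⟩
  change ((Θ.toEquiv i (Φ.symb i x) : G i) : L) = y
  rw [LieFiltration.symb, hx, LinearEquiv.apply_symm_apply]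

namespace HasSymbol

theorem mem (h : Θ.HasSymbol i x y) : x ∈ Φ.F i := h.1

theorem mem_grading (h : Θ.HasSymbol i x y) : y ∈ G i := by
  obtain ⟨hx, rfl⟩ := h
  exact Subtype.property (Θ.toEquiv i (Φ.symb i ⟨x, hx⟩))

theorem exists_of_mem (Θ : Φ.GradedIso G) (hx : x ∈ Φ.F i) : ∃ y, Θ.HasSymbol i x y :=
  ⟨_, hx, rfl⟩

theorem eq (h : Θ.HasSymbol i x y) (h' : Θ.HasSymbol i x y') : y = y' :=
  h.2.symm.trans h'.2

theorem add (h : Θ.HasSymbol i x y) (h' : Θ.HasSymbol i x' y') :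
    Θ.HasSymbol i (x + x') (y + y') := by
  obtain ⟨hx, rfl⟩ := h
  obtain ⟨hx', rfl⟩ := h'
  exact ⟨add_mem hx hx', map_add (Θ.symbol i) ⟨x, hx⟩ ⟨x', hx'⟩⟩

theorem sub (h : Θ.HasSymbol i x y) (h' : Θ.HasSymbol i x' y') :
    Θ.HasSymbol i (x - x') (y - y') := by
  obtain ⟨hx, rfl⟩ := h
  obtain ⟨hx', rfl⟩ := h'
  exact ⟨sub_mem hx hx', map_sub (Θ.symbol i) ⟨x, hx⟩ ⟨x', hx'⟩⟩

theorem smul (t : K) (h : Θ.HasSymbol i x y) : Θ.HasSymbol i (t • x) (t • y) := by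
  obtain ⟨hx, rfl⟩ := h
  exact ⟨Submodule.smul_mem _ t hx, map_smul (Θ.symbol i) t ⟨x, hx⟩⟩

theorem lie (h : Θ.HasSymbol i x y) (h' : Θ.HasSymbol j x' y') (hk : i + j = k) :
    Θ.HasSymbol k ⁅x, x'⁆ ⁅y, y'⁆ := by
  subst hk
  obtain ⟨hx, rfl⟩ := h
  obtain ⟨hx', rfl⟩ := h'
  exact ⟨Φ.lie_mem hx hx', Θ.map_lie i j ⟨x, hx⟩ ⟨x', hx'⟩⟩

theorem zero_iff (hk : i + 1 = k) : Θ.HasSymbol i x 0 ↔ x ∈ Φ.F k := by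
  subst hk
  constructor
  · rintro ⟨hx, h⟩
    exact (symbol_eq_zero_iff _).1 h
  · intro h
    have hx : x ∈ Φ.F i := Φ.antitone (by omega) h
    exact ⟨hx, (symbol_eq_zero_iff _).2 h⟩

theorem sub_mem (h : Θ.HasSymbol i x y) (h' : Θ.HasSymbol i x' y) (hk : i + 1 = k) :
    x - x' ∈ Φ.F k :=
  (zero_iff hk).1 (by simpa using h.sub h')

/-- The symbol map is onto `G i`, and over a field every module is projective, so lifts can be
chosen linearly in any dimension. -/
theorem exists_lift (Θ : Φ.GradedIso G) {V : Type*} [AddCommGroup V] [Module K V] (l : V →ₗ[K] L)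
    (hl : ∀ a, l a ∈ G i) : ∃ g : V →ₗ[K] M, ∀ a, Θ.HasSymbol i (g a) (l a) := by
  obtain ⟨r, hr⟩ := Module.projective_lifting_property
    ((Θ.symbol i).codRestrict (G i) fun x => mem_grading ⟨x.2, rfl⟩) (l.codRestrict (G i) hl)
    (fun y => by
      obtain ⟨x, hx⟩ := exists_symbol_eq (Θ := Θ) y.2
      exact ⟨x, Subtype.ext hx⟩)
  refine ⟨(Φ.F i).subtype ∘ₗ r, fun a => ⟨(r a).2, ?_⟩⟩
  exact congrArg Subtype.val (LinearMap.congr_fun hr a)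

end HasSymbol

end LieFiltration.GradedIso

end Symbols

/-! ### Splitting a filtered deformation by a lift of `h ⊗ 1` -/

section Sections

variable {K : Type*} [Field K] [CharP K 2] {M : Type*} [LieRing M] [LieAlgebra K M]

/-- The square of a derivation is a derivation in characteristic 2, because the cross term occurs
twice. -/
theorem lie_lie_lie_of_charTwo (K : Type*) [Field K] [CharP K 2] {M : Type*} [LieRing M]
    [LieAlgebra K M] (u x y : M) :
    ⁅u, ⁅u, ⁅x, y⁆⁆⁆ = ⁅⁅u, ⁅u, x⁆⁆, y⁆ + ⁅x, ⁅u, ⁅u, y⁆⁆⁆ := by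
  have h := add_self_eq_zero_of_charTwo (K := K) ⁅⁅u, x⁆, ⁅u, y⁆⁆
  rw [leibniz_lie u x y, lie_add, leibniz_lie u ⁅u, x⁆ y, leibniz_lie u x ⁅u, y⁆]
  rw [add_assoc, ← add_assoc ⁅⁅u, x⁆, ⁅u, y⁆⁆, h, zero_add]

variable {A : Type*} [CommRing A] [Algebra K A] {D : Derivation K A A} {Φ : LieFiltration K M}

/-- Graded components below degree `-1` vanish, so the filtration is constant there, and
exhaustiveness makes the constant value everything. -/
theorem filtration_neg_one (Θ : Φ.GradedIso (stdGrading D)) : Φ.F (-1) = ⊤ := by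
  have step (i : ℤ) (h1 : i ≠ -1) (h2 : i ≠ 0) (h3 : i ≠ 1) : Φ.F i ≤ Φ.F (i + 1) := by
    intro x hx
    obtain ⟨y, hy⟩ := LieFiltration.GradedIso.HasSymbol.exists_of_mem Θ hx
    have h0 := hy.mem_grading
    rw [stdGrading_eq_bot D h1 h2 h3, Submodule.mem_bot] at h0
    subst h0
    exact (LieFiltration.GradedIso.HasSymbol.zero_iff rfl).1 hy
  have down (n : ℕ) : Φ.F (-1 - n) ≤ Φ.F (-1) := by
    induction n with
    | zero => simp
    | succ n ih =>
      refine (step _ (by omega) (by omega) (by omega)).trans ?_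
      convert ih using 2
      push_cast
      ring
  rw [eq_top_iff, ← Φ.exhaustive]
  refine iSup_le fun i => ?_
  rcases le_total (-1) i with h | h
  · exact Φ.antitone h
  · obtain ⟨n, hn⟩ := Int.eq_ofNat_of_zero_le (show 0 ≤ -1 - i by omega)
    have : i = -1 - n := by omega
    rw [this]
    exact down n

/-- From degree 2 on the filtration is constant, and separatedness makes the constant value zero. -/
theorem filtration_two (Θ : Φ.GradedIso (stdGrading D)) : Φ.F 2 = ⊥ := by
  have step (i : ℤ) (h1 : 2 ≤ i) : Φ.F i ≤ Φ.F (i + 1) := by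
    intro x hx
    obtain ⟨y, hy⟩ := LieFiltration.GradedIso.HasSymbol.exists_of_mem Θ hx
    have h0 := hy.mem_grading
    rw [stdGrading_eq_bot D (by omega) (by omega) (by omega), Submodule.mem_bot] at h0
    subst h0
    exact (LieFiltration.GradedIso.HasSymbol.zero_iff rfl).1 hy
  have up (n : ℕ) : Φ.F 2 ≤ Φ.F (2 + n) := by
    induction n with
    | zero => simp
    | succ n ih =>
      refine ih.trans ((step _ (by omega)).trans (le_of_eq ?_))
      congr 1
  rw [eq_bot_iff, ← Φ.separated]
  refine le_iInf fun i => ?_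
  rcases le_total i 2 with h | h
  · exact Φ.antitone h
  · obtain ⟨n, hn⟩ := Int.eq_ofNat_of_zero_le (show 0 ≤ i - 2 by omega)
    have : i = 2 + n := by omega
    rw [this]
    exact up n

-- Arbitrary lifts satisfy the bracket relations only modulo the next filtration term. Lifts
-- homogeneous for the `ℤ/2`-grading defined by `ad u` have no error terms raising the degree by
-- one, and by two is all that the length of the filtration still permits.
open LieFiltration.GradedIso in
theorem exists_isLieFrame (hD : D ≠ 0) (Θ : Φ.GradedIso (stdGrading D)) :
    ∃ (E H F : A →ₗ[K] M) (d : M), IsLieFrame D E H F d := by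
  have htop := filtration_neg_one Θ
  have hbot := filtration_two Θ
  obtain ⟨E₀, hE₀⟩ := HasSymbol.exists_lift Θ (i := -1) (tens D (Ess.e K)) fun a => by
    rw [stdGrading_neg_one]; exact ⟨a, rfl⟩
  obtain ⟨H₀, hH₀⟩ := HasSymbol.exists_lift Θ (i := 0) (tens D (Ess.h K)) fun a => by
    rw [mem_stdGrading_zero]; exact ⟨a, 0, by rw [zero_smul, add_zero]⟩
  obtain ⟨F, hF⟩ := HasSymbol.exists_lift Θ (i := 1) (tens D (Ess.f K)) fun a => by
    rw [stdGrading_one]; exact ⟨a, rfl⟩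
  obtain ⟨⟨d₀, hd₀'⟩, hd₀⟩ := exists_symbol_eq (Θ := Θ) (i := 0) (y := derElt D) (by
    rw [mem_stdGrading_zero]; exact ⟨0, 1, by rw [one_smul, map_zero, zero_add]⟩)
  replace hd₀ : Θ.HasSymbol 0 d₀ (derElt D) := ⟨hd₀', hd₀⟩
  clear hd₀'
  have symm1 {x : M} (hx : x ∈ Φ.F (-1)) : ∃ a, Θ.HasSymbol (-1) x (tens D (Ess.e K) a) := by
    obtain ⟨y, hy⟩ := HasSymbol.exists_of_mem Θ hx
    have := hy.mem_grading
    rw [stdGrading_neg_one] at this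
    obtain ⟨a, rfl⟩ := this
    exact ⟨a, hy⟩
  have sym0 {x : M} (hx : x ∈ Φ.F 0) :
      ∃ (b : A) (t : K), Θ.HasSymbol 0 x (tens D (Ess.h K) b + t • derElt D) := by
    obtain ⟨y, hy⟩ := HasSymbol.exists_of_mem Θ hx
    obtain ⟨b, t, rfl⟩ := (mem_stdGrading_zero D).1 hy.mem_grading
    exact ⟨b, t, hy⟩
  have sym1 {x : M} (hx : x ∈ Φ.F 1) : ∃ c, x = F c := by
    obtain ⟨y, hy⟩ := HasSymbol.exists_of_mem Θ hx
    have := hy.mem_grading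
    rw [stdGrading_one] at this
    obtain ⟨c, rfl⟩ := this
    have h0 := hy.sub_mem (hF c) (show (1 : ℤ) + 1 = 2 by rfl)
    rw [hbot, Submodule.mem_bot, sub_eq_zero] at h0
    exact ⟨c, h0⟩
  have eqF {x x' : M} {y : CurrentExt D} (hx : Θ.HasSymbol 1 x y) (hx' : Θ.HasSymbol 1 x' y) :
      x = x' := by
    have h0 := hx.sub_mem hx' (show (1 : ℤ) + 1 = 2 by rfl)
    rwa [hbot, Submodule.mem_bot, sub_eq_zero] at h0
  -- On the graded algebra `ad (h ⊗ 1)` is the identity in degrees `±1` and zero in degree 0, the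
  -- latter because `[h,h] = 0` and `D 1 = 0`. The next facts are the filtered version.
  set u := H₀ 1
  have hu0 : Θ.HasSymbol 0 u (tens D (Ess.h K) 1) := hH₀ 1
  have uF (c : A) : ⁅u, F c⁆ = F c := by
    refine eqF (hu0.lie (hF c) (zero_add 1)) ?_
    rw [lie_comm_of_charTwo K, lie_tens_tens, Ess.lie_f_h, mul_one]
    exact hF c
  have u1 {x : M} (hx : x ∈ Φ.F 1) : ⁅u, x⁆ = x := by
    obtain ⟨c, rfl⟩ := sym1 hx
    exact uF c
  have u0 {x : M} (hx : x ∈ Φ.F 0) : ⁅u, x⁆ ∈ Φ.F 1 := by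
    obtain ⟨b, t, h⟩ := sym0 hx
    refine (HasSymbol.zero_iff (Θ := Θ) (zero_add 1)).1 ?_
    have := hu0.lie h (zero_add 0)
    rwa [lie_add, lie_smul, lie_tens_tens, lie_tens_derElt, lie_self, Derivation.map_one_eq_zero,
      map_zero, smul_zero, add_zero, tens_zero] at this
  have um {x : M} : ⁅u, x⁆ - x ∈ Φ.F 0 := by
    obtain ⟨a, ha⟩ := symm1 (x := x) (htop ▸ Submodule.mem_top)
    have := hu0.lie ha (zero_add (-1))
    rw [lie_comm_of_charTwo K (tens D _ _), lie_tens_tens, Ess.lie_e_h, mul_one] at this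
    exact this.sub_mem ha (by rfl)
  -- With `T = ad u`, the element `T (T x - x)` lies in `F 1`, where `T` is the identity; hence `T³
  -- x - T² x = T² x - T x`, and `2 T² x = 0`.
  have cube (x : M) : ⁅u, ⁅u, ⁅u, x⁆⁆⁆ = ⁅u, x⁆ := by
    have := u1 (u0 (um (x := x)))
    simp only [lie_sub] at this
    have k := add_self_eq_zero_of_charTwo (K := K) ⁅u, ⁅u, x⁆⁆
    rw [sub_eq_iff_eq_add.1 this, sub_add_eq_add_sub, k, zero_sub, neg_eq_of_charTwo K]
  -- the kernel of `ad u` and the fixed space of its square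
  have ker0 {x : M} (hx : ⁅u, x⁆ = 0) : x ∈ Φ.F 0 := by
    have := um (x := x)
    rw [hx, zero_sub] at this
    simpa using this
  have ker1 {x : M} (hx : ⁅u, x⁆ = 0) (hx1 : x ∈ Φ.F 1) : x = 0 := by
    rw [← u1 hx1, hx]
  have fix1 {x : M} (hx : ⁅u, ⁅u, x⁆⁆ = x) (hx0 : x ∈ Φ.F 0) : x ∈ Φ.F 1 := by
    rw [← hx, u1 (u0 hx0)]
    exact u0 hx0
  have ker_of_sq {x : M} (hx : ⁅u, ⁅u, x⁆⁆ = 0) : ⁅u, x⁆ = 0 := by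
    rw [← cube, hx, lie_zero]
  -- Parity rules: the kernel of `ad u` is even and the fixed space of its square is odd.
  have ker_lie {x y : M} (hx : ⁅u, x⁆ = 0) (hy : ⁅u, y⁆ = 0) : ⁅u, ⁅x, y⁆⁆ = 0 := by
    rw [leibniz_lie, hx, hy, zero_lie, lie_zero, add_zero]
  have fix_lie {x y : M} (hx : ⁅u, ⁅u, x⁆⁆ = x) (hy : ⁅u, ⁅u, y⁆⁆ = y) : ⁅u, ⁅x, y⁆⁆ = 0 := by
    apply ker_of_sq
    rw [lie_lie_lie_of_charTwo K, hx, hy, add_self_eq_zero_of_charTwo (K := K)]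
  have fix_ker {x y : M} (hx : ⁅u, ⁅u, x⁆⁆ = x) (hy : ⁅u, y⁆ = 0) :
      ⁅u, ⁅u, ⁅x, y⁆⁆⁆ = ⁅x, y⁆ := by
    rw [lie_lie_lie_of_charTwo K, hx, hy, lie_zero, lie_zero, add_zero]
  -- An even element is determined by its symbol in degree 0. An odd element is determined by its
  -- symbol in degree `-1` only up to the range of `F`, which is where the terms raising the degree
  -- by two survive.
  have ker_eq {x x' : M} {y : CurrentExt D} (hx : ⁅u, x⁆ = 0) (hx' : ⁅u, x'⁆ = 0)
      (h : Θ.HasSymbol 0 x y) (h' : Θ.HasSymbol 0 x' y) : x = x' := by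
    refine sub_eq_zero.1 (ker1 ?_ (h.sub_mem h' (zero_add 1)))
    rw [lie_sub, hx, hx', sub_zero]
  have fix_eq {x x' : M} {y : CurrentExt D} (hx : ⁅u, ⁅u, x⁆⁆ = x) (hx' : ⁅u, ⁅u, x'⁆⁆ = x')
      (h : Θ.HasSymbol (-1) x y) (h' : Θ.HasSymbol (-1) x' y) : ∃ c, x = x' + F c := by
    obtain ⟨c, hc⟩ := sym1 (fix1 (x := x - x') (by rw [lie_sub, lie_sub, hx, hx'])
      (h.sub_mem h' (by rfl)))
    exact ⟨c, by rw [← hc]; abel⟩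
  -- the corrected lifts
  let T : M →ₗ[K] M := LieModule.toEnd K M M u
  let E : A →ₗ[K] M := T ∘ₗ T ∘ₗ E₀
  let H : A →ₗ[K] M := H₀ - T ∘ₗ H₀
  let d : M := d₀ - ⁅u, d₀⁆
  have Efix (a) : ⁅u, ⁅u, E a⁆⁆ = E a := by
    change ⁅u, ⁅u, ⁅u, ⁅u, E₀ a⁆⁆⁆⁆ = ⁅u, ⁅u, E₀ a⁆⁆
    rw [cube]
  have Ffix (a) : ⁅u, ⁅u, F a⁆⁆ = F a := by rw [uF, uF]
  -- On `F 0` the map `ad u` takes values in `F 1`, where it is the identity. So `1 - ad u` sends `F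
  -- 0` into the kernel, and it keeps symbols of degree 0.
  have kerp {x : M} (hx : x ∈ Φ.F 0) : ⁅u, x - ⁅u, x⁆⁆ = 0 := by
    rw [lie_sub, u1 (u0 hx), sub_self]
  have Hker (a) : ⁅u, H a⁆ = 0 := kerp (hH₀ a).mem
  have dker : ⁅u, d⁆ = 0 := kerp hd₀.mem
  have symp {x : M} {y : CurrentExt D} (h : Θ.HasSymbol 0 x y) : Θ.HasSymbol 0 (x - ⁅u, x⁆) y := by
    have := h.sub ((HasSymbol.zero_iff (Θ := Θ) (zero_add 1)).2 (u0 h.mem))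
    rwa [sub_zero] at this
  have hH (a) : Θ.HasSymbol 0 (H a) (tens D (Ess.h K) a) := symp (hH₀ a)
  have hd : Θ.HasSymbol 0 d (derElt D) := symp hd₀
  have hE (a) : Θ.HasSymbol (-1) (E a) (tens D (Ess.e K) a) := by
    have := hu0.lie (hu0.lie (hE₀ a) (zero_add (-1))) (zero_add (-1))
    rwa [lie_comm_of_charTwo K (tens D _ _) (tens D _ a), lie_tens_tens, Ess.lie_e_h, mul_one,
      lie_comm_of_charTwo K (tens D _ _) (tens D _ a), lie_tens_tens, Ess.lie_e_h, mul_one] at this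
  have hker {x : M} (hx : ⁅u, x⁆ = 0) : ∃ (b : A) (t : K), x = H b + t • d := by
    obtain ⟨b, t, h⟩ := sym0 (ker0 hx)
    refine ⟨b, t, ker_eq hx ?_ h ((hH b).add (hd.smul t))⟩
    rw [lie_add, lie_smul, Hker, dker, smul_zero, add_zero]
  have inj (a b c : A) (t : K) (h : stdCoord D hD (a, b, c, t) = 0) :
      a = 0 ∧ b = 0 ∧ c = 0 ∧ t = 0 := by
    rw [LinearEquiv.map_eq_zero_iff] at h
    simpa using h
  refine ⟨E, H, F, d, ?_⟩
  constructor
  · constructor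
    · rw [← LinearMap.ker_eq_bot, LinearMap.ker_eq_bot']
      rintro ⟨a, b, c, t⟩ h0
      rw [frameMap_apply] at h0
      -- Coefficients are removed in order of degree: the symbol of the lowest remaining term must
      -- vanish, since the other terms lie deeper in the filtration.
      have hHd := (hH b).add (hd.smul t)
      have hF1 := (hF c).mem
      have ha : a = 0 := by
        have h1 : E a ∈ Φ.F 0 := by
          rw [eq_neg_of_add_eq_zero_left h0, add_left_comm, add_comm]
          exact neg_mem (add_mem hHd.mem (Φ.antitone zero_le_one hF1))
        have h2 := (hE a).eq ((HasSymbol.zero_iff (by rfl)).2 h1)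
        exact (inj a 0 0 0 (by rw [stdCoord_apply, h2]; simp only [map_zero, zero_smul, add_zero])).1
      subst ha
      rw [map_zero, zero_add, add_left_comm] at h0
      have h1 : H b + t • d ∈ Φ.F 1 := by
        rw [eq_neg_of_add_eq_zero_right h0]
        exact neg_mem hF1
      have h2 := hHd.eq ((HasSymbol.zero_iff (zero_add 1)).2 h1)
      obtain ⟨-, rfl, -, rfl⟩ := inj 0 b 0 t (by
        rw [stdCoord_apply, map_zero, map_zero, zero_add, zero_add, h2])
      rw [map_zero, zero_smul, add_zero, add_zero] at h0
      have h3 := (hF c).eq ((HasSymbol.zero_iff (k := 2) (by rfl)).2 (by rw [h0]; exact zero_mem _))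
      obtain ⟨-, -, rfl, -⟩ := inj 0 0 c 0 (by
        rw [stdCoord_apply, h3, map_zero, map_zero, zero_smul, add_zero, add_zero, add_zero])
      rfl
    · intro x
      obtain ⟨a, ha⟩ := symm1 (x := x) (htop ▸ Submodule.mem_top)
      have h1 := ha.sub_mem (hE a) (show (-1 : ℤ) + 1 = 0 by rfl)
      obtain ⟨b, t, hb⟩ := sym0 h1
      obtain ⟨c, hc⟩ := sym1 (hb.sub_mem ((hH b).add (hd.smul t)) (zero_add 1))
      refine ⟨(a, b, c, t), ?_⟩
      rw [frameMap_apply, ← hc]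
      abel
  · exact fun a b => hker (fix_lie (Efix a) (Efix b))
  · intro a b
    refine fix_eq (fix_ker (Efix a) (Hker b)) (Efix _) ((hE a).lie (hH b) (add_zero _)) ?_
    rw [lie_tens_tens, Ess.lie_e_h]
    exact hE _
  · intro a b
    refine ker_eq (fix_lie (Efix a) (Ffix b)) (Hker _) ((hE a).lie (hF b) (by rfl)) ?_
    rw [lie_tens_tens, Ess.lie_e_f]
    exact hH _
  · intro a
    refine fix_eq (fix_ker (Efix a) dker) (Efix _) ((hE a).lie hd (add_zero _)) ?_
    rw [lie_tens_derElt]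
    exact hE _
  · intro a b
    refine ker1 (ker_lie (Hker a) (Hker b)) ((HasSymbol.zero_iff (Θ := Θ) (zero_add 1)).1 ?_)
    have := (hH a).lie (hH b) (zero_add 0)
    rwa [lie_tens_tens, lie_self, tens_zero] at this
  · intro a b
    refine eqF ((hH a).lie (hF b) (zero_add _)) ?_
    rw [lie_comm_of_charTwo K, lie_tens_tens, Ess.lie_f_h, mul_comm]
    exact hF _
  · intro a
    refine ker_eq (ker_lie (Hker a) dker) (Hker _) ((hH a).lie hd (add_zero _)) ?_
    rw [lie_tens_derElt]
    exact hH _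
  · intro a b
    have h2 := Φ.lie_mem (hF a).mem (hF b).mem
    rwa [show (1 : ℤ) + 1 = 2 by rfl, hbot, Submodule.mem_bot] at h2
  · intro a
    refine eqF ((hF a).lie hd (add_zero _)) ?_
    rw [lie_tens_derElt]
    exact hF _

end Sections

end SmallDeform

end

theorem mainTheorem3 {K : Type*} [Field K] [CharP K 2] {A : Type*} [CommRing A] [Algebra K A]
    (D : Derivation K A A) (hD : D ≠ 0) :
    (∀ (v w : A) (ξ : A →ₗ[K] K), SmallDeform.IsAdmissible D v w ξ →
      ∃! B : SmallDeform.CurrentExt D →ₗ[K] SmallDeform.CurrentExt D →ₗ[K]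
          SmallDeform.CurrentExt D,
        SmallDeform.IsDeformedBracket D v w ξ B ∧ SmallDeform.IsJacobi B) ∧
    (∀ (M : Type*) [LieRing M] [LieAlgebra K M],
      SmallDeform.IsFilteredDeformation K (SmallDeform.stdGrading D) M →
      ∃ (v w : A) (ξ : A →ₗ[K] K), SmallDeform.IsAdmissible D v w ξ ∧
        ∃ B : SmallDeform.CurrentExt D →ₗ[K] SmallDeform.CurrentExt D →ₗ[K]
            SmallDeform.CurrentExt D,
          SmallDeform.IsDeformedBracket D v w ξ B ∧
          ∃ φ : M ≃ₗ[K] SmallDeform.CurrentExt D, ∀ x y : M, φ ⁅x, y⁆ = B (φ x) (φ y)) := by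
  refine ⟨fun v w ξ h => SmallDeform.existsUnique_deformedBracket hD h, ?_⟩
  rintro M _ _ ⟨Φ, ⟨Θ⟩⟩
  obtain ⟨E, H, F, d, h⟩ := SmallDeform.exists_isLieFrame hD Θ
  exact h.exists_deformedBracket hD
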